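/- For $n\ge 1$ let $SU(n)$ be the special unitary group of $n\times n$ complex matrices with its usual topology, and let $\prod_{n=1}^{\infty}SU(n)$ carry the product topology. Let $\mathcal S=\mathcal S\bigl(\prod_{n=1}^\infty SU(n)\bigr)$ be the space of all compact subgroups of $\prod_{n=1}^{\infty}SU(n)$, topologized as a subspace of the space of nonempty compact subsets of $\prod_{n=1}^{\infty}SU(n)$ with the Vietoris topology (equivalently, with the Hausdorff metric induced by any compatible metric on the product). For a topological group $G$ let $G^\circ$ denote its identity component, that is, the connected component of the identity element. Then for the generic $G\in\mathcal S$ (that is, for all $G$ in a set whose complement is meager in $\mathcal S$) the quotient $G/G^\circ$, with the quotient topology, is homeomorphic to the Cantor set. Consequently, the generic $G\in\mathcal S$ is not connected. -/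

import Mathlib

/-- The special unitary group `SU(n)`, with the topology inherited from complex matrices. -/
abbrev SU (n : ℕ) : Type := Matrix.specialUnitaryGroup (Fin n) ℂ

instance SU.instIsTopologicalGroup (n : ℕ) : IsTopologicalGroup (SU n) where
  continuous_mul := continuous_mul
  continuous_inv := Continuous.subtype_mk (continuous_star.comp continuous_subtype_val) _

/-- The topological group `∏_{n ≥ 1} SU(n)`, with the product topology. -/
abbrev ProdSU : Type := ∀ n : ℕ+, SU (n : ℕ)

/-- The set of compact subgroups of `G` inside the space of nonempty compact subsets of `G`. As a
type it carries the subspace topology of the Vietoris topology, which is the topology of the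
Hausdorff metric of any compatible metric on `G`. -/
def CompactSubgroups (G : Type*) [TopologicalSpace G] [Group G] :
    Set (TopologicalSpace.NonemptyCompacts G) :=
  {K | ∃ H : Subgroup G, (H : Set G) = (K : Set G)}

/-- A point of the space of compact subgroups, viewed as a subgroup (with the same elements). -/
def CompactSubgroups.toSubgroup {G : Type*} [TopologicalSpace G] [Group G]
    (K : CompactSubgroups G) : Subgroup G where
  carrier := (K.1 : Set G)
  one_mem' := by obtain ⟨H, hH⟩ := K.2; rw [← hH]; exact H.one_mem
  mul_mem' := by obtain ⟨H, hH⟩ := K.2; rw [← hH]; exact H.mul_mem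
  inv_mem' := by obtain ⟨H, hH⟩ := K.2; rw [← hH]; exact H.inv_mem

/-!
A compact set has infinitely many components exactly when, for every `n`, disjoint open sets cut it
into `n` nonempty pieces; this is a countable intersection of Vietoris open conditions. It is also a
dense condition on compact subgroups of a product with infinitely many factors containing a
disconnected compact subgroup: keep finitely many coordinates of `K` and replace the others by a box
of such subgroups. The modified subgroup depends continuously on the set of kept coordinates, hence
tends to `K` as this set grows, and it surjects onto an infinite product of disconnected spaces.

If a compact metrizable group `G` has infinitely many components, then `G ⧸ G°`, the space of
components, is compact, metrizable, totally disconnected, infinite and homogeneous, hence perfect.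
Such a space is the Cantor set by Brouwer's theorem: a separating sequence of clopen sets can be
refined to one in which any finitely many sets are independent, and the indicator functions of the
refined sequence then define a bijection onto `ℕ → Bool`. In `SU(n)`, `n ≥ 2` even, `{1, -1}` is a
disconnected compact subgroup.
-/

open Set Filter Topology TopologicalSpace Function

section Brouwer

variable {X : Type*} [TopologicalSpace X]

theorem exists_continuousMap_bool_apply_ne [TotallySeparatedSpace X] {x y : X} (hxy : x ≠ y) :
    ∃ b : C(X, Bool), b x ≠ b y := by
  obtain ⟨U, hU, hx, hy⟩ := exists_isClopen_of_totally_separated hxy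
  refine ⟨⟨U.boolIndicator, (continuous_boolIndicator_iff_isClopen U).2 hU⟩, ?_⟩
  simp [(U.mem_iff_boolIndicator x).1 hx, (U.notMem_iff_boolIndicator y).1 hy]

theorem exists_seq_continuousMap_bool_separating [CompactSpace X] [TotallySeparatedSpace X]
    [SecondCountableTopology X] :
    ∃ u : ℕ → C(X, Bool), ∀ x y, (∀ n, u n x = u n y) → x = y := by
  have : Countable (Clopens X) := Clopens.countable_iff_secondCountable.2 inferInstance
  obtain ⟨U, hU⟩ := exists_surjective_nat (Clopens X)
  refine ⟨fun n => ⟨(U n : Set X).boolIndicator,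
    (continuous_boolIndicator_iff_isClopen _).2 (U n).isClopen⟩, fun x y hxy => ?_⟩
  by_contra hne
  obtain ⟨W, hW, hx, hy⟩ := exists_isClopen_of_totally_separated hne
  obtain ⟨n, hn⟩ := hU ⟨W, hW⟩
  have h := hxy n
  simp only [ContinuousMap.coe_mk, hn, Clopens.coe_mk, (W.mem_iff_boolIndicator x).1 hx,
    (W.notMem_iff_boolIndicator y).1 hy, Bool.true_eq_false] at h

variable [TotallySeparatedSpace X] [PerfectSpace X]

theorem exists_surjOn_bool_refining (u : C(X, Bool)) {C : Set X} (hC : IsOpen C)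
    (hne : C.Nonempty) :
    ∃ b : C(X, Bool), SurjOn b C univ ∧ ∀ x ∈ C, ∀ y ∈ C, b x = b y → u x = u y := by
  have surjOn_of_ne (b : C(X, Bool)) {x y : X} (hx : x ∈ C) (hy : y ∈ C) (hxy : b x ≠ b y) :
      SurjOn b C univ := fun i _ => by
    rcases Bool.eq_or_eq_not i (b x) with rfl | rfl
    · exact ⟨x, hx, rfl⟩
    · exact ⟨y, hy, Bool.eq_not.2 hxy.symm⟩
  by_cases hu : ∃ x ∈ C, ∃ y ∈ C, u x ≠ u y
  · obtain ⟨x, hx, y, hy, hxy⟩ := hu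
    exact ⟨u, surjOn_of_ne u hx hy hxy, fun _ _ _ _ h => h⟩
  · push Not at hu
    obtain ⟨x, hx⟩ := hne
    obtain ⟨y, hyx, hy⟩ := (PerfectSpace.not_isolated x).nonempty_of_mem
      (inter_mem self_mem_nhdsWithin (mem_nhdsWithin_of_mem_nhds (hC.mem_nhds hx)))
    obtain ⟨b, hb⟩ := exists_continuousMap_bool_apply_ne (Ne.symm hyx)
    exact ⟨b, surjOn_of_ne b hx hy hb, fun x hx y hy _ => hu x hx y hy⟩

theorem exists_surjective_prod_bool_refining {D : Type*} [TopologicalSpace D] [DiscreteTopology D]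
    {f : C(X, D)} (hf : Surjective f) (u : C(X, Bool)) :
    ∃ b : C(X, Bool), Surjective (fun x => (f x, b x)) ∧
      ∀ x y, f x = f y → b x = b y → u x = u y := by
  have hopen (d : D) : IsOpen (f ⁻¹' {d}) := (isOpen_discrete {d}).preimage f.continuous
  choose b hsurj hrefine using fun d : D =>
    exists_surjOn_bool_refining u (hopen d) ((singleton_nonempty d).preimage hf)
  have hcont : Continuous fun x => b (f x) x := continuous_iff_continuousAt.2 fun x =>
    (b (f x)).continuous.continuousAt.congr <| by
      filter_upwards [(hopen (f x)).mem_nhds rfl] with y hy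
      rw [show f y = f x from hy]
  refine ⟨⟨_, hcont⟩, ?_, fun x y hxy hb => ?_⟩
  · rintro ⟨d, i⟩
    obtain ⟨x, rfl, hx⟩ := hsurj d (mem_univ i)
    exact ⟨x, Prod.ext rfl hx⟩
  · exact hrefine (f x) x rfl y hxy.symm (by simpa only [ContinuousMap.coe_mk, hxy] using hb)

theorem exists_surjective_fin_succ_bool_refining {n : ℕ} {f : C(X, Fin n → Bool)}
    (hf : Surjective f) (u : C(X, Bool)) :
    ∃ g : C(X, Fin (n + 1) → Bool), Surjective g ∧ (∀ x, Fin.init (g x) = f x) ∧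
      ∀ x y, g x = g y → u x = u y := by
  obtain ⟨b, hsurj, hrefine⟩ := exists_surjective_prod_bool_refining hf u
  refine ⟨⟨fun x => Fin.snoc (f x) (b x), by fun_prop⟩, fun a => ?_, fun x => ?_,
    fun x y hxy => ?_⟩
  · obtain ⟨x, hx⟩ := hsurj (Fin.init a, a (Fin.last n))
    obtain ⟨hinit, hlast⟩ := Prod.mk.inj hx
    exact ⟨x, by simp only [ContinuousMap.coe_mk, hinit, hlast, Fin.snoc_init_self]⟩
  · exact Fin.init_snoc (α := fun _ => Bool) (b x) (f x)
  · obtain ⟨hfxy, hbxy⟩ := (Fin.snoc_inj (α := fun _ => Bool)).1 hxy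
    exact hrefine x y hfxy hbxy

theorem exists_seq_bool_independent_refining [Nonempty X] (u : ℕ → C(X, Bool)) :
    ∃ b : ℕ → C(X, Bool), (∀ n, Surjective fun x (i : Fin n) => b i x) ∧
      ∀ x y, (∀ n, b n x = b n y) → ∀ n, u n x = u n y := by
  choose next hnext hinit hrefine using fun n
    (f : {f : C(X, Fin n → Bool) // Surjective f}) =>
      exists_surjective_fin_succ_bool_refining f.2 (u n)
  let f : ∀ n, {f : C(X, Fin n → Bool) // Surjective f} :=
    Nat.rec ⟨.const X Fin.elim0, surjective_to_subsingleton _⟩ fun n f => ⟨next n f, hnext n f⟩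
  let b (n : ℕ) : C(X, Bool) := ⟨fun x => (f (n + 1)).1 x (Fin.last n), by fun_prop⟩
  have hfb (n : ℕ) (x : X) : (f n).1 x = fun i : Fin n => b i x := by
    induction n with
    | zero => exact Subsingleton.elim _ _
    | succ n ih =>
      funext i
      induction i using Fin.lastCases with
      | last => rfl
      | cast i => exact (congrFun ((hinit n (f n) x).trans ih) i :)
  refine ⟨b, fun n => ?_, fun x y hxy n => hrefine n (f n) x y ?_⟩
  · convert (f n).2 using 2 with x
    exact (hfb n x).symm
  · change (f (n + 1)).1 x = (f (n + 1)).1 y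
    simp only [hfb, hxy]

/-- **Brouwer's characterization of the Cantor space.** -/
theorem nonempty_homeomorph_nat_bool [CompactSpace X] [SecondCountableTopology X] [Nonempty X] :
    Nonempty (X ≃ₜ (ℕ → Bool)) := by
  obtain ⟨u, hu⟩ := exists_seq_continuousMap_bool_separating (X := X)
  obtain ⟨b, hindep, hrefine⟩ := exists_seq_bool_independent_refining u
  let e (x : X) (n : ℕ) : Bool := b n x
  have hcont : Continuous e := by fun_prop
  have hinj : Injective e := fun x y hxy => hu x y (hrefine x y (congrFun hxy))
  have hsurj : Surjective e := by
    intro a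
    choose x hx using fun n => hindep n fun i => a i
    have hlim : Tendsto (fun n => e (x n)) atTop (𝓝 a) := tendsto_pi_nhds.2 fun k =>
      tendsto_const_nhds.congr' <| by
        filter_upwards [eventually_gt_atTop k] with n hn
        exact (congrFun (hx n) ⟨k, hn⟩).symm
    exact (isCompact_range hcont).isClosed.mem_of_tendsto hlim
      (.of_forall fun n => mem_range_self (x n))
  exact ⟨hcont.homeoOfEquivCompactToT2 (f := Equiv.ofBijective e ⟨hinj, hsurj⟩)⟩

end Brouwer

section ComponentGroup

theorem perfectSpace_of_isPretransitive (G : Type*) {X : Type*} [Group G] [TopologicalSpace X]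
    [MulAction G X] [ContinuousConstSMul G X] [MulAction.IsPretransitive G X] [CompactSpace X]
    [Infinite X] : PerfectSpace X := by
  refine perfectSpace_iff_forall_not_isolated.2 fun x => neBot_iff.2 fun hx => ?_
  rw [← isOpen_singleton_iff_punctured_nhds] at hx
  have : DiscreteTopology X := discreteTopology_iff_isOpen_singleton.2 fun y => by
    obtain ⟨g, rfl⟩ := MulAction.exists_smul_eq G x y
    rw [← smul_set_singleton]
    exact hx.smul g
  exact not_finite_iff_infinite.2 ‹_› (finite_of_compact_of_discrete (X := X))

variable {G : Type*} [TopologicalSpace G] [Group G] [IsTopologicalGroup G]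

theorem inv_mul_mem_connectedComponentOfOne_iff {x y : G} :
    x⁻¹ * y ∈ Subgroup.connectedComponentOfOne G ↔
      connectedComponent x = connectedComponent y := by
  have himage : (x * ·) '' connectedComponent 1 = connectedComponent x := by
    have h := (Homeomorph.mulLeft x).image_connectedComponentIn (mem_univ 1)
    rw [image_univ, (Homeomorph.mulLeft x).range_coe] at h
    simpa only [connectedComponentIn_univ, Homeomorph.coe_mulLeft, mul_one] using h
  rw [eq_comm, connectedComponent_eq_iff_mem, ← himage, image_mul_left, mem_preimage]
  rfl

variable (G) in
/-- The quotient by the identity component, viewed as the space of connected components: the cosets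
of `G°` are the components. -/
def quotientConnectedComponentOfOneHomeomorph :
    G ⧸ Subgroup.connectedComponentOfOne G ≃ₜ ConnectedComponents G :=
  Homeomorph.Quotient.congrRight fun _ _ =>
    QuotientGroup.leftRel_apply.trans inv_mul_mem_connectedComponentOfOne_iff

theorem nonempty_quotient_connectedComponentOfOne_homeomorph_cantorSet [CompactSpace G]
    [T2Space G] [SecondCountableTopology G] [Infinite (ConnectedComponents G)] :
    Nonempty (G ⧸ Subgroup.connectedComponentOfOne G ≃ₜ cantorSet) := by
  let e := quotientConnectedComponentOfOneHomeomorph G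
  have : Infinite (G ⧸ Subgroup.connectedComponentOfOne G) := e.toEquiv.infinite_iff.2 ‹_›
  have : T2Space (G ⧸ Subgroup.connectedComponentOfOne G) := e.symm.t2Space
  have : TotallyDisconnectedSpace (G ⧸ Subgroup.connectedComponentOfOne G) :=
    e.symm.totallyDisconnectedSpace
  have : PerfectSpace (G ⧸ Subgroup.connectedComponentOfOne G) := perfectSpace_of_isPretransitive G
  obtain ⟨f⟩ := nonempty_homeomorph_nat_bool (X := G ⧸ Subgroup.connectedComponentOfOne G)
  exact ⟨f.trans cantorSetHomeomorphNatToBool.symm⟩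

end ComponentGroup

section InfiniteComponents

variable {X : Type*} [TopologicalSpace X]

/-- `K` is cut into pieces indexed by `ι` by pairwise disjoint open sets of the ambient space. The
ambient formulation makes this visibly an open condition in the Vietoris topology. -/
def SplitsInto (K : Set X) (ι : Type*) : Prop :=
  ∃ U : ι → Set X, (∀ i, IsOpen (U i)) ∧ Pairwise (Disjoint on U) ∧ K ⊆ ⋃ i, U i ∧
    ∀ i, (K ∩ U i).Nonempty

theorem isOpen_setOf_splitsInto (ι : Type*) [Finite ι] :
    IsOpen {K : NonemptyCompacts X | SplitsInto (K : Set X) ι} := by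
  refine isOpen_iff_mem_nhds.2 ?_
  rintro K ⟨U, hU, hdisj, hcover, hmeet⟩
  filter_upwards [(NonemptyCompacts.isOpen_subsets_of_isOpen (isOpen_iUnion hU)).mem_nhds hcover,
    eventually_all.2 fun i =>
      (NonemptyCompacts.isOpen_inter_nonempty_of_isOpen (hU i)).mem_nhds (hmeet i)]
    with L hLcover hLmeet
  exact ⟨U, hU, hdisj, hLcover, hLmeet⟩

theorem SplitsInto.exists_injective_connectedComponents {K : Set X} {ι : Type*}
    (h : SplitsInto K ι) : ∃ c : ι → ConnectedComponents K, Injective c := by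
  obtain ⟨U, hU, hdisj, hcover, hmeet⟩ := h
  choose x hxK hxU using hmeet
  have isClopen_piece (i : ι) : IsClopen ((↑) ⁻¹' U i : Set K) := by
    refine isClopen_of_disjoint_cover_open (b := (↑) ⁻¹' ⋃ j ≠ i, U j) ?_
      ((hU i).preimage continuous_subtype_val)
      ((isOpen_biUnion fun j _ => hU j).preimage continuous_subtype_val)
      ((disjoint_iUnion₂_right.2 fun j hj => hdisj hj.symm).preimage _)
    rintro y -
    obtain ⟨j, hj⟩ := mem_iUnion.1 (hcover y.2)
    rcases eq_or_ne j i with rfl | hji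
    · exact .inl hj
    · exact .inr (mem_biUnion hji hj)
  refine ⟨fun i => ConnectedComponents.mk ⟨x i, hxK i⟩, fun i j hij => ?_⟩
  by_contra hne
  have hji : x j ∈ U i := (isClopen_piece i).connectedComponent_subset (x := ⟨x i, hxK i⟩) (hxU i)
    (connectedComponent_eq_iff_mem.1 (ConnectedComponents.coe_eq_coe.1 hij.symm))
  exact (hdisj hne).notMem_of_mem_left hji (hxU j)

theorem splitsInto_of_isClopen [T2Space X] {K : Set X} (hK : IsCompact K) {ι : Type*} [Finite ι]
    {V : ι → Set K} (hV : ∀ i, IsClopen (V i)) (hne : ∀ i, (V i).Nonempty)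
    (hdisj : Pairwise (Disjoint on V)) (hcover : ⋃ i, V i = univ) : SplitsInto K ι := by
  have := isCompact_iff_compactSpace.1 hK
  let C (i : ι) : Set X := (↑) '' V i
  have hC (i : ι) : IsCompact (C i) := (hV i).isClosed.isCompact.image continuous_subtype_val
  have hnhds : Pairwise (Disjoint on fun i => 𝓝ˢ (C i)) := fun i j hij =>
    (SeparatedNhds.of_isCompact_isCompact (hC i) (hC j)
      (disjoint_image_of_injective Subtype.val_injective (hdisj hij))).disjoint_nhdsSet
  obtain ⟨N, hN, hNdisj⟩ := hnhds.exists_mem_filter_of_disjoint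
  refine ⟨fun i => interior (N i), fun i => isOpen_interior,
    fun i j hij => (hNdisj hij).mono interior_subset interior_subset, fun x hx => ?_, fun i => ?_⟩
  · obtain ⟨i, hi⟩ := mem_iUnion.1 (hcover.symm ▸ mem_univ (⟨x, hx⟩ : K))
    exact mem_iUnion.2 ⟨i, subset_interior_iff_mem_nhdsSet.2 (hN i) (mem_image_of_mem _ hi)⟩
  · obtain ⟨x, hx⟩ := hne i
    exact ⟨x, x.2, subset_interior_iff_mem_nhdsSet.2 (hN i) (mem_image_of_mem _ hx)⟩

theorem infinite_connectedComponents_iff_forall_splitsInto [T2Space X] {K : Set X}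
    (hK : IsCompact K) :
    Infinite (ConnectedComponents K) ↔ ∀ n : ℕ, SplitsInto K (Fin (n + 1)) := by
  refine ⟨fun _ n => ?_, fun h => not_finite_iff_infinite.1 fun _ => ?_⟩
  · obtain ⟨V, hV, hne, hdisj, hcover⟩ :=
      ConnectedComponents.exists_fun_isClopen_of_infinite K (n + 1) n.succ_pos
    exact splitsInto_of_isClopen hK hV hne hdisj hcover
  · obtain ⟨c, hc⟩ := (h (Nat.card (ConnectedComponents K))).exists_injective_connectedComponents
    simpa only [Nat.card_eq_fintype_card, Fintype.card_fin, Nat.succ_le_iff, lt_self_iff_false]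
      using Nat.card_le_card_of_injective c hc

theorem isGδ_setOf_infinite_connectedComponents [T2Space X] :
    IsGδ {K : NonemptyCompacts X | Infinite (ConnectedComponents (K : Set X))} := by
  have hinter : {K : NonemptyCompacts X | Infinite (ConnectedComponents (K : Set X))} =
      ⋂ n : ℕ, {K : NonemptyCompacts X | SplitsInto (K : Set X) (Fin (n + 1))} := by
    ext K
    simpa only [mem_ofPred_eq, mem_iInter] using
      infinite_connectedComponents_iff_forall_splitsInto K.isCompact
  rw [hinter]
  exact .iInter_of_isOpen fun n => isOpen_setOf_splitsInto (Fin (n + 1))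

end InfiniteComponents

section Splice

theorem nontrivial_connectedComponents {X : Type*} [TopologicalSpace X]
    (h : ¬ PreconnectedSpace X) : Nontrivial (ConnectedComponents X) := by
  contrapose! h
  exact preconnectedSpace_iff_connectedComponent.2 fun x => eq_univ_of_forall fun y =>
    ConnectedComponents.coe_eq_coe'.1 (Subsingleton.elim _ _)

theorem infinite_connectedComponents_of_surjective_pi {X J : Type*} [TopologicalSpace X]
    [Infinite J] {A : J → Type*} [∀ j, TopologicalSpace (A j)]
    [∀ j, Nontrivial (ConnectedComponents (A j))] {f : X → ∀ j, A j} (hf : Continuous f)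
    (hsurj : Surjective f) : Infinite (ConnectedComponents X) := by
  let g (x : X) (j : J) : ConnectedComponents (A j) := f x j
  have hg : Continuous g := continuous_pi fun j =>
    ConnectedComponents.continuous_coe.comp ((continuous_apply j).comp hf)
  have hgsurj : Surjective g := by
    intro c
    choose a ha using fun j => ConnectedComponents.surjective_coe (c j)
    obtain ⟨x, rfl⟩ := hsurj a
    exact ⟨x, funext ha⟩
  refine Infinite.of_surjective hg.connectedComponentsLift fun c => ?_
  obtain ⟨x, rfl⟩ := hgsurj c
  exact ⟨x, hg.connectedComponentsLift_apply_coe x⟩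

theorem tendsto_decide_mem_finset {ι : Type*} [DecidableEq ι] :
    Tendsto (fun (F : Finset ι) i => decide (i ∈ F)) atTop (𝓝 fun _ => true) := by
  refine tendsto_pi_nhds.2 fun i => tendsto_const_nhds.congr' ?_
  filter_upwards [eventually_ge_atTop {i}] with F hF
  exact (decide_eq_true (hF (Finset.mem_singleton_self i))).symm

variable {ι : Type*} {Y : ι → Type*} [∀ i, Group (Y i)]

variable (Y) in
/-- The homomorphism gluing two elements of a product: the coordinates with `s i = true` come from
the first one, the others from the second. -/
def spliceHom (s : ι → Bool) : (∀ i, Y i) × (∀ i, Y i) →* ∀ i, Y i where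
  toFun p i := bif s i then p.1 i else p.2 i
  map_one' := funext fun i => by cases s i <;> rfl
  map_mul' p q := funext fun i => by cases h : s i <;> simp [h]

variable [∀ i, TopologicalSpace (Y i)]

theorem continuous_spliceHom :
    Continuous fun p : (ι → Bool) × (∀ i, Y i) × (∀ i, Y i) => spliceHom Y p.1 p.2 := by
  refine continuous_pi fun i => ?_
  have h : Continuous fun q : Bool × Y i × Y i => bif q.1 then q.2.1 else q.2.2 := by
    refine continuous_prod_of_discrete_left.2 fun b => ?_
    cases b
    · exact continuous_snd
    · exact continuous_fst
  exact h.comp (f := fun p : (ι → Bool) × (∀ i, Y i) × (∀ i, Y i) => (p.1 i, p.2.1 i, p.2.2 i))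
    (by fun_prop)

/-- The compact subgroup obtained from `K` by replacing its coordinates outside `{i | s i = true}`
by those of `Z`, independently of the kept ones. -/
def CompactSubgroups.splice (K Z : CompactSubgroups (∀ i, Y i)) (s : ι → Bool) :
    CompactSubgroups (∀ i, Y i) :=
  ⟨(K.1 ×ˢ Z.1).map (spliceHom Y s)
      (continuous_spliceHom.comp (by fun_prop : Continuous fun p => (s, p))),
    ((toSubgroup K).prod (toSubgroup Z)).map (spliceHom Y s), rfl⟩

theorem CompactSubgroups.continuous_splice (K Z : CompactSubgroups (∀ i, Y i)) :
    Continuous (splice K Z) :=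
  (continuous_const.nonemptyCompacts_map' continuous_spliceHom).subtype_mk _

theorem CompactSubgroups.splice_const_true (K Z : CompactSubgroups (∀ i, Y i)) :
    splice K Z (fun _ => true) = K := by
  refine Subtype.ext (SetLike.coe_injective ?_)
  exact fst_image_prod (K.1 : Set (∀ i, Y i)) Z.1.nonempty

/-- The box with sides `Z i`, as a compact subgroup of the product. -/
def CompactSubgroups.pi (Z : ∀ i, Subgroup (Y i)) (hZ : ∀ i, IsCompact (Z i : Set (Y i))) :
    CompactSubgroups (∀ i, Y i) :=
  ⟨⟨⟨univ.pi fun i => (Z i : Set (Y i)), isCompact_univ_pi hZ⟩, 1, (Subgroup.pi univ Z).one_mem⟩,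
    Subgroup.pi univ Z, rfl⟩

theorem CompactSubgroups.infinite_connectedComponents_splice (K : CompactSubgroups (∀ i, Y i))
    {Z : ∀ i, Subgroup (Y i)} (hZ : ∀ i, IsCompact (Z i : Set (Y i))) {s : ι → Bool}
    (hs : {i | s i = false ∧ ¬ IsPreconnected (Z i : Set (Y i))}.Infinite) :
    Infinite (ConnectedComponents ((splice K (pi Z hZ) s).1 : Set (∀ i, Y i))) := by
  let J := {i | s i = false ∧ ¬ IsPreconnected (Z i : Set (Y i))}
  have : Infinite J := hs.to_subtype
  have (j : J) : Nontrivial (ConnectedComponents (Z j)) :=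
    nontrivial_connectedComponents fun h => j.2.2 (isPreconnected_iff_preconnectedSpace.2 h)
  have spliceHom_apply (p : (∀ i, Y i) × (∀ i, Y i)) (j : J) : spliceHom Y s p j = p.2 j :=
    congrArg (bif · then p.1 j else p.2 j) j.2.1
  have hmem (x : (splice K (pi Z hZ) s).1) (j : J) : x.1 j ∈ Z j := by
    obtain ⟨_, p, ⟨-, hp⟩, rfl⟩ := x
    exact (congrArg (· ∈ Z j) (spliceHom_apply p j)).mpr (hp j (mem_univ _))
  refine infinite_connectedComponents_of_surjective_pi (A := fun j : J => Z j)
    (f := fun x j => ⟨x.1 j, hmem x j⟩)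
    (continuous_pi fun j => ((continuous_apply _).comp continuous_subtype_val).subtype_mk _)
    fun z => ?_
  obtain ⟨y, rfl⟩ := Subtype.surjective_restrict (β := fun i => Z i) (· ∈ J) z
  have hy : spliceHom Y s (1, fun i => y i) ∈ (splice K (pi Z hZ) s).1 :=
    mem_image_of_mem (spliceHom Y s) ⟨(toSubgroup K).one_mem, fun i _ => (y i).2⟩
  exact ⟨⟨_, hy⟩, funext fun j => Subtype.ext (spliceHom_apply _ j)⟩

theorem CompactSubgroups.dense_setOf_infinite_connectedComponents
    (hinf : {i | ∃ Z : Subgroup (Y i),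
      IsCompact (Z : Set (Y i)) ∧ ¬ IsPreconnected (Z : Set (Y i))}.Infinite) :
    Dense {K : CompactSubgroups (∀ i, Y i) |
      Infinite (ConnectedComponents (K.1 : Set (∀ i, Y i)))} := by
  classical
  let S := {i | ∃ Z : Subgroup (Y i),
    IsCompact (Z : Set (Y i)) ∧ ¬ IsPreconnected (Z : Set (Y i))}
  have hexists (i : ι) : ∃ Z : Subgroup (Y i), IsCompact (Z : Set (Y i)) ∧
      (i ∈ S → ¬ IsPreconnected (Z : Set (Y i))) := by
    by_cases hi : i ∈ S
    · obtain ⟨Z, hZ, hpre⟩ := hi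
      exact ⟨Z, hZ, fun _ => hpre⟩
    · exact ⟨⊥, isCompact_singleton, fun h => (hi h).elim⟩
  choose Z hZ hpre using hexists
  intro K
  have htendsto : Tendsto (fun F : Finset ι => splice K (pi Z hZ) fun i => decide (i ∈ F)) atTop
      (𝓝 K) := by
    have h := (continuous_splice K (pi Z hZ)).tendsto fun _ => true
    rw [splice_const_true] at h
    exact h.comp tendsto_decide_mem_finset
  refine mem_closure_of_tendsto htendsto (.of_forall fun F => ?_)
  refine infinite_connectedComponents_splice K hZ ((hinf.sdiff F.finite_toSet).mono ?_)
  exact fun i hi => ⟨decide_eq_false hi.2, hpre i hi.1⟩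

theorem CompactSubgroups.eventually_residual_infinite_connectedComponents [∀ i, T2Space (Y i)]
    (hinf : {i | ∃ Z : Subgroup (Y i),
      IsCompact (Z : Set (Y i)) ∧ ¬ IsPreconnected (Z : Set (Y i))}.Infinite) :
    ∀ᶠ K : CompactSubgroups (∀ i, Y i) in residual (CompactSubgroups (∀ i, Y i)),
      Infinite (ConnectedComponents (toSubgroup K)) :=
  residual_of_dense_Gδ
    (.preimage (f := Subtype.val) continuous_subtype_val isGδ_setOf_infinite_connectedComponents)
    (dense_setOf_infinite_connectedComponents hinf)

end Splice

theorem theorem5p8_general {ι : Type*} [Countable ι] {Y : ι → Type*} [∀ i, Group (Y i)]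
    [∀ i, TopologicalSpace (Y i)] [∀ i, IsTopologicalGroup (Y i)] [∀ i, T2Space (Y i)]
    [∀ i, SecondCountableTopology (Y i)]
    (hinf : {i | ∃ Z : Subgroup (Y i),
      IsCompact (Z : Set (Y i)) ∧ ¬ IsPreconnected (Z : Set (Y i))}.Infinite) :
    (∀ᶠ K : CompactSubgroups (∀ i, Y i) in residual (CompactSubgroups (∀ i, Y i)),
      Nonempty ((CompactSubgroups.toSubgroup K ⧸
        Subgroup.connectedComponentOfOne (CompactSubgroups.toSubgroup K)) ≃ₜ cantorSet)) ∧
    (∀ᶠ K : CompactSubgroups (∀ i, Y i) in residual (CompactSubgroups (∀ i, Y i)),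
      ¬ ConnectedSpace (CompactSubgroups.toSubgroup K)) := by
  have hgeneric := CompactSubgroups.eventually_residual_infinite_connectedComponents hinf
  refine ⟨hgeneric.mono fun K _ => ?_, hgeneric.mono fun K _ _ => not_finite
    (ConnectedComponents (CompactSubgroups.toSubgroup K))⟩
  have : CompactSpace (CompactSubgroups.toSubgroup K) :=
    isCompact_iff_compactSpace.1 K.1.isCompact
  have : SecondCountableTopology (CompactSubgroups.toSubgroup K) :=
    Subtype.secondCountableTopology _
  exact nonempty_quotient_connectedComponentOfOne_homeomorph_cantorSet

section SpecialUnitaryGroup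

instance SU.instSecondCountableTopology (n : ℕ) : SecondCountableTopology (SU n) :=
  have : SecondCountableTopology (Matrix (Fin n) (Fin n) ℂ) :=
    inferInstanceAs (SecondCountableTopology (Fin n → Fin n → ℂ))
  Subtype.secondCountableTopology _

theorem neg_one_mem_specialUnitaryGroup {n R : Type*} [Fintype n] [DecidableEq n] [CommRing R]
    [StarRing R] (hn : Even (Fintype.card n)) :
    (-1 : Matrix n n R) ∈ Matrix.specialUnitaryGroup n R :=
  Matrix.mem_specialUnitaryGroup_iff.2
    ⟨(-1 : unitary (Matrix n n R)).2, by
      rw [Matrix.det_neg, hn.neg_one_pow, one_mul, Matrix.det_one]⟩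

theorem not_isPreconnected_zpowers {G : Type*} [Group G] [TopologicalSpace G] [T1Space G] {g : G}
    (hg : g ≠ 1) (hfin : IsOfFinOrder g) : ¬ IsPreconnected (Subgroup.zpowers g : Set G) :=
  fun h => h.infinite_of_nontrivial
    ⟨g, Subgroup.mem_zpowers g, 1, one_mem _, hg⟩ (finite_zpowers.2 hfin)

theorem SU.infinite_setOf_exists_isCompact_not_isPreconnected :
    {n : ℕ+ | ∃ Z : Subgroup (SU n),
      IsCompact (Z : Set (SU n)) ∧ ¬ IsPreconnected (Z : Set (SU n))}.Infinite := by
  refine infinite_of_injective_forall_mem (f := (2 * · : ℕ+ → ℕ+)) (mul_right_injective 2)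
    fun n => ?_
  have heven : Even (Fintype.card (Fin (2 * n : ℕ+))) := by
    rw [Fintype.card_fin, PNat.mul_coe]
    exact even_two_mul _
  let g : SU (2 * n : ℕ+) := ⟨-1, neg_one_mem_specialUnitaryGroup heven⟩
  have hfin : IsOfFinOrder g := isOfFinOrder_iff_pow_eq_one.2
    ⟨2, two_pos, Subtype.ext (neg_one_sq (R := Matrix _ _ ℂ))⟩
  have hne : g ≠ 1 := fun h => by
    have hentry := congrFun₂ (congrArg Subtype.val h) 0 0
    norm_num [g] at hentry
  exact ⟨.zpowers g, (finite_zpowers.2 hfin).isCompact, not_isPreconnected_zpowers hne hfin⟩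

end SpecialUnitaryGroup

theorem theorem5p8 :
    (∀ᶠ K : CompactSubgroups ProdSU in residual (CompactSubgroups ProdSU),
      Nonempty ((CompactSubgroups.toSubgroup K ⧸
        Subgroup.connectedComponentOfOne (CompactSubgroups.toSubgroup K)) ≃ₜ cantorSet)) ∧
    (∀ᶠ K : CompactSubgroups ProdSU in residual (CompactSubgroups ProdSU),
      ¬ ConnectedSpace (CompactSubgroups.toSubgroup K)) :=
  theorem5p8_general SU.infinite_setOf_exists_isCompact_not_isPreconnected
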